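/- Let $\mathbb{T}^2=[0,1)^2$ be the two-dimensional torus, and let $\hat f(k)=\int_{\mathbb{T}^2}e^{-\mathrm{i}k\cdot x}f(x)\,\mathrm{d}x$, $k\in(2\pi\mathbb{Z})^2$, denote Fourier coefficients, extended to periodic Schwartz distributions; $|\partial_1|^{s}$ is the Fourier multiplier $|k_1|^s$, acting on distributions without modes $k_1=0$. Let $P$ be the projection onto zero average in $x_1$ (removing all modes with $k_1=0$) and $\mathcal{L}=-\partial_1^2-|\partial_1|^{-1}\partial_2^2$. For a periodic distribution $\xi$ and $u\in L^2(\mathbb{T}^2)$ real-valued with zero average in $x_1$ consider $$E_{tot}(u)=\int_{\mathbb{T}^2}(\partial_1u)^2\,\mathrm{d}x+\int_{\mathbb{T}^2}\Big(|\partial_1|^{-\frac12}\big(\partial_2u-\partial_1\tfrac12u^2\big)\Big)^2\mathrm{d}x-2\int_{\mathbb{T}^2}\xi u\,\mathrm{d}x ,$$ understood by Parseval as the unconditional sum, in $[-\infty,\infty]$, over all $k\in(2\pi\mathbb{Z})^2$ of the contributions of the Fourier modes $$e_k(u)=|k_1\hat u(k)|^2+\Big||k_1|^{-\frac12}\big(k_2\hat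 u(k)-k_1\widehat{\tfrac12u^2}(k)\big)\Big|^2-2\,\mathrm{Re}\big(\hat\xi(k)\overline{\hat u(k)}\big)$$ (the second term is $0$ for $k_1=0$); thus $E_{tot}(u)=-\infty$ means that $\sum_k\max(e_k(u),0)<\infty$ and $\sum_k\max(-e_k(u),0)=\infty$. Let also $$\mathcal{H}(u)=\int_{\mathbb{T}^2}(\partial_1u)^2\,\mathrm{d}x+\int_{\mathbb{T}^2}(|\partial_1|^{-\frac12}\partial_2u)^2\,\mathrm{d}x\in[0,\infty]$$ be the harmonic energy, the integrals being read by Parseval as well. **Proposition.** Let $\xi$ be distributed according to the law of white noise on $\mathbb{T}^2$, i.e. $\xi$ is a random real periodic Schwartz distribution such that $\xi(\varphi)$ is a centred Gaussian with variance $\int_{\mathbb{T}^2}\varphi^2\,\mathrm{d}x$ for every $\varphi\in C^\infty(\mathbb{T}^2)$. Then, almost surely, the equation $\mathcal{L}v=P\xi$ has exactly one solution $v\in L^2(\mathbb{T}^2)$ with vanishing average in $x_1$, and for this $v$: 1. $\displaystyle\mathcal{H}(v)=\sum_{k\in(2\pi\mathbb{Z})^2,\,k_1\ne0}\frac{|\hat\xi(k)|^2}{k_1^2+|k_1|^{-1}k_2^2}=+\infty$;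 2. the quartic term is finite: $\displaystyle\int_{\mathbb{T}^2}\Big(|\partial_1|^{-\frac12}\partial_1\tfrac12v^2\Big)^2\mathrm{d}x<\infty$; 3. $E_{tot}(v)=-\infty$. -/

import Mathlib

open MeasureTheory

noncomputable section

namespace Ripple

/-- The two-dimensional torus `𝕋² = (ℝ/ℤ)²`; the coordinate `x₁` has index `0`, `x₂` index `1`. -/
abbrev Torus : Type := UnitAddTorus (Fin 2)

/-- Lebesgue measure on `𝕋²` (total mass one). -/
def torusMeasure : Measure Torus :=
  Measure.pi fun _ : Fin 2 => (AddCircle.haarAddCircle : Measure UnitAddCircle)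

/-- The `ℤ²`-periodic function on `ℝ²` corresponding to a function on the torus. -/
def periodicLift (f : Torus → ℝ) : (Fin 2 → ℝ) → ℝ :=
  fun x => f fun i => (x i : UnitAddCircle)

/-- The space `C^∞(𝕋²)` of real-valued smooth periodic functions. -/
def testFunctions : Submodule ℝ (Torus → ℝ) where
  carrier := {f | ContDiff ℝ ((⊤ : ℕ∞) : WithTop ℕ∞) (periodicLift f)}
  add_mem' := by
    intro f g hf hg
    rw [Set.mem_ofPred_eq] at hf hg ⊢
    exact hf.add hg
  zero_mem' := by
    rw [Set.mem_ofPred_eq]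
    exact contDiff_const
  smul_mem' := by
    intro c f hf
    rw [Set.mem_ofPred_eq] at hf ⊢
    exact contDiff_const.smul hf

/-- Periodic Schwartz distributions: the real linear functionals on `C^∞(𝕋²)` that are continuous
for the Fréchet topology given by the suprema of the derivatives of all orders, that is, those that
are bounded by a multiple of the maximum of finitely many of these suprema. -/
structure PeriodicDistribution where
  /-- the underlying linear functional -/
  toLinearMap : testFunctions →ₗ[ℝ] ℝ
  continuous' : ∃ (N : ℕ) (C : ℝ), ∀ (φ : testFunctions) (B : ℝ),
    (∀ j ≤ N, ∀ x : Fin 2 → ℝ, ‖iteratedFDeriv ℝ j (periodicLift φ) x‖ ≤ B) →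
      |toLinearMap φ| ≤ C * B

instance : CoeFun PeriodicDistribution fun _ => testFunctions → ℝ :=
  ⟨fun ξ => ξ.toLinearMap⟩

/-- The σ-algebra on the space of periodic distributions generated by the evaluations
`ξ ↦ ξ(φ)`, `φ ∈ C^∞(𝕋²)`. -/
instance : MeasurableSpace PeriodicDistribution :=
  ⨆ φ : testFunctions, MeasurableSpace.comap (fun ξ : PeriodicDistribution => ξ φ) inferInstance

/-- `μ` is the law of (periodic) white noise: under `μ`, every `ξ(φ)` is a centred Gaussian with
variance `∫ φ² dx`. By linearity of `ξ` this fixes all finite-dimensional distributions. -/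
def IsWhiteNoise (μ : Measure PeriodicDistribution) : Prop :=
  ∀ φ : testFunctions, μ.map (fun ξ : PeriodicDistribution => ξ φ) =
    ProbabilityTheory.gaussianReal 0
      (Real.toNNReal (∫ x, (φ : Torus → ℝ) x ^ 2 ∂torusMeasure))

lemma contDiff_mFourier (n : Fin 2 → ℤ) :
    ContDiff ℝ ((⊤ : ℕ∞) : WithTop ℕ∞)
      (fun x : Fin 2 → ℝ => UnitAddTorus.mFourier n fun i => (x i : UnitAddCircle)) := by
  simp only [UnitAddTorus.mFourier, ContinuousMap.coe_mk, fourier_coe_apply]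
  refine contDiff_prod fun i _ => Complex.contDiff_exp.comp ?_
  refine (contDiff_const.mul (Complex.ofRealCLM.contDiff.comp (contDiff_apply ℝ ℝ i))).div_const _

/-- The test function `x ↦ cos (2π n·x)`. -/
def cosTest (n : Fin 2 → ℤ) : testFunctions :=
  ⟨fun x => (UnitAddTorus.mFourier n x).re, Complex.reCLM.contDiff.comp (contDiff_mFourier n)⟩

/-- The test function `x ↦ sin (2π n·x)`. -/
def sinTest (n : Fin 2 → ℤ) : testFunctions :=
  ⟨fun x => (UnitAddTorus.mFourier n x).im, Complex.imCLM.contDiff.comp (contDiff_mFourier n)⟩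

/-- The wave number `k_{i+1} = 2π n_i`, where `n ∈ ℤ²` indexes `k ∈ (2πℤ)²`. -/
def wave (n : Fin 2 → ℤ) (i : Fin 2) : ℝ := 2 * Real.pi * n i

/-- Fourier coefficient `ξ̂(k) = ξ(e^{-ik·x})` of a periodic distribution, `k = 2πn`. -/
def PeriodicDistribution.coeff (ξ : PeriodicDistribution) (n : Fin 2 → ℤ) : ℂ :=
  (ξ (cosTest n) : ℂ) - Complex.I * (ξ (sinTest n) : ℂ)

/-- Fourier coefficient `û(k) = ∫ e^{-ik·x} u(x) dx`, `k = 2πn`, of a real function on the torus. -/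
def coeff (u : Torus → ℝ) (n : Fin 2 → ℤ) : ℂ :=
  UnitAddTorus.mFourierCoeff (fun x => (u x : ℂ)) n

/-- The symbol `k₁² + |k₁|⁻¹ k₂²` of `𝓛 = -∂₁² - |∂₁|⁻¹ ∂₂²` (used only where `k₁ ≠ 0`). -/
def symbolL (n : Fin 2 → ℤ) : ℝ :=
  wave n 0 ^ 2 + |wave n 0|⁻¹ * wave n 1 ^ 2

/-- `v` has vanishing average in `x₁` and solves `𝓛 v = P ξ`, where `P` is the projection onto
functions of vanishing average in `x₁`. On Fourier coefficients: vanishing average means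
`v̂(0, k₂) = 0`, and since both sides of the equation have no modes with `k₁ = 0`, the equation
amounts to the identity of the coefficients at all `k` with `k₁ ≠ 0`. -/
structure IsLinearSolution (ξ : PeriodicDistribution) (v : Torus → ℝ) : Prop where
  zero_average : ∀ n : Fin 2 → ℤ, n 0 = 0 → coeff v n = 0
  equation : ∀ n : Fin 2 → ℤ, n 0 ≠ 0 → (symbolL n : ℂ) * coeff v n = ξ.coeff n

/-- Fourier coefficients of `∂₁ u`. -/
def coeffD1 (u : Torus → ℝ) (n : Fin 2 → ℤ) : ℂ := Complex.I * wave n 0 * coeff u n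

/-- Fourier coefficients of `∂₂ u`. -/
def coeffD2 (u : Torus → ℝ) (n : Fin 2 → ℤ) : ℂ := Complex.I * wave n 1 * coeff u n

/-- Multiplier `|k₁|^{-1/2}` of `|∂₁|^{-1/2}` (it only ever acts on distributions without modes
`k₁ = 0`, and has the value `0` there). -/
def halfInv (n : Fin 2 → ℤ) : ℂ := ((|wave n 0| ^ (-(1 / 2) : ℝ) : ℝ) : ℂ)

/-- The function `u²/2`. -/
def halfSq (u : Torus → ℝ) : Torus → ℝ := fun x => u x ^ 2 / 2

/-- Harmonic energy `𝓗(u) = ∫ (∂₁u)² dx + ∫ (|∂₁|^{-1/2} ∂₂u)² dx ∈ [0, ∞]`; the integral of the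
square of a distribution is the (possibly infinite) squared `ℓ²`-norm of its Fourier coefficients. -/
def harmonicEnergy (u : Torus → ℝ) : ENNReal :=
  (∑' n : Fin 2 → ℤ, ENNReal.ofReal (‖coeffD1 u n‖ ^ 2)) +
    ∑' n : Fin 2 → ℤ, ENNReal.ofReal (‖halfInv n * coeffD2 u n‖ ^ 2)

/-- The quartic term `∫ (|∂₁|^{-1/2} ∂₁ (u²/2))² dx ∈ [0, ∞]`. -/
def quarticEnergy (u : Torus → ℝ) : ENNReal :=
  ∑' n : Fin 2 → ℤ, ENNReal.ofReal (‖halfInv n * coeffD1 (halfSq u) n‖ ^ 2)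

/-- The contribution of the Fourier mode `k = 2πn` to the total energy of `u` with noise `ξ`,
`|(∂₁u)^(k)|² + |(|∂₁|^{-1/2} (∂₂u - ∂₁ u²/2))^(k)|² - 2 Re (ξ̂(k) conj û(k))`. -/
def totalEnergyMode (ξ : PeriodicDistribution) (u : Torus → ℝ) (n : Fin 2 → ℤ) : ℝ :=
  ‖coeffD1 u n‖ ^ 2 + ‖halfInv n * (coeffD2 u n - coeffD1 (halfSq u) n)‖ ^ 2
    - 2 * (ξ.coeff n * (starRingEnd ℂ) (coeff u n)).re

/-- Total energy
`E_tot(u) = ∫ (∂₁u)² dx + ∫ (|∂₁|^{-1/2} (∂₂u - ∂₁ u²/2))² dx - 2 ∫ ξ u dx`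
for `u` with vanishing average in `x₁`, as an extended real number: by Parseval, the sum over all
Fourier modes of the energy per mode. The sum is unconditional (limit in `[-∞, ∞]` along all finite
sets of modes), so the value is `-∞` exactly if the sum of the positive parts of the contributions
is finite and the sum of the negative parts is infinite. -/
def totalEnergy (ξ : PeriodicDistribution) (u : Torus → ℝ) : EReal :=
  ∑' n : Fin 2 → ℤ, (totalEnergyMode ξ u n : EReal)

end Ripple

end

noncomputable section

namespace Ripple

variable {μ : Measure PeriodicDistribution} {ξ : PeriodicDistribution}

/-! Write `σ` for the symbol of `𝓛`. The solution must have coefficients `v̂ = σ⁻¹ ξ̂`, and the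
`ξ̂(k)` are Gaussian with `E ξ̂(m) ξ̂(n) = 1` if `m + n = 0` and `0` otherwise. Everything rests on
two deterministic facts: `∑ σ⁻¹ = ∞` (`not_summable_inv_symbolL`) and `∑ |k₁| σ⁻² < ∞`
(`summable_abs_wave_mul_inv_symbolL_sq`), the latter also giving `∑ σ⁻² < ∞`.

Since `E ∑ σ⁻² |ξ̂|² = ∑ σ⁻²` is finite, `v` exists in `L²` almost surely. Its harmonic energy `∑
σ⁻¹ |ξ̂|²` has partial sums of unbounded mean but bounded variance, so Chebyshev makes it infinite
almost surely (`ae_tsum_eq_top`).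

The coefficients of `v²` are convolutions of `σ⁻¹ ξ̂` with itself. By Isserlis, for `k ≠ 0` their
second moment is at most `2 ∑ₘ σ(m)⁻² σ(k-m)⁻²`. The weight `|k₁| ≤ |m₁| + |k₁ - m₁|` falls on one
factor, so the expected quartic energy is finite (`ae_tsum_convolution_lt_top`).

In the total energy the noise term contributes `-2 σ⁻¹ |ξ̂|²` per mode, twice the harmonic part with
the opposite sign. Young's inequality absorbs the cubic cross term, leaving at most minus half the
harmonic part plus three times the quartic part (`totalEnergyMode_le`), which sums to `-∞`. -/

/-! ### Second and fourth moments of white noise; Isserlis' theorem. -/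

open ProbabilityTheory in
lemma integral_pow_four_gaussianReal (v : NNReal) :
    ∫ x, x ^ 4 ∂gaussianReal 0 v = 3 * (v : ℝ) ^ 2 := by
  have h := iteratedDeriv_mgf_zero (X := fun x : ℝ => x) (μ := gaussianReal 0 v) (by simp) 4
  rw [mgf_fun_id_gaussianReal] at h
  simp only [Pi.pow_apply] at h
  rw [← h]
  -- Differentiating `p(t) exp(v t²/2)` replaces `p` by `p' + v t p`; four rounds starting from `p =
  -- 1` give the fourth derivative of the moment generating function.
  have d : ∀ p : Polynomial ℝ,
      deriv (fun t => p.eval t * Real.exp (0 * t + v * t ^ 2 / 2)) =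
        fun t => (p.derivative + p * (Polynomial.C (v : ℝ) * Polynomial.X)).eval t *
          Real.exp (0 * t + v * t ^ 2 / 2) := by
    intro p
    ext t
    have h1 : HasDerivAt (fun t : ℝ => 0 * t + v * t ^ 2 / 2) (v * t) t := by
      have := ((hasDerivAt_id t).const_mul 0).add
        ((((hasDerivAt_id t).pow 2).const_mul (v : ℝ)).div_const 2)
      refine this.congr_deriv ?_
      simp
      ring
    refine (((p.hasDerivAt t).mul h1.exp).congr_deriv ?_).deriv
    simp
    ring
  have e0 : (fun t : ℝ => Real.exp (0 * t + v * t ^ 2 / 2)) =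
      fun t => (1 : Polynomial ℝ).eval t * Real.exp (0 * t + v * t ^ 2 / 2) := by simp
  simp only [iteratedDeriv_succ, iteratedDeriv_zero]
  rw [e0, d, d, d, d]
  simp
  ring


lemma measurable_eval (φ : testFunctions) :
    Measurable (fun ξ : PeriodicDistribution => ξ φ) :=
  Measurable.of_comap_le (le_iSup (fun φ : testFunctions =>
    MeasurableSpace.comap (fun ξ : PeriodicDistribution => ξ φ) inferInstance) φ)

lemma IsWhiteNoise.isProbabilityMeasure (hμ : IsWhiteNoise μ) : IsProbabilityMeasure μ := by
  constructor
  have h := congrArg (fun m => m Set.univ) (hμ 0)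
  simpa [Measure.map_apply (measurable_eval 0) MeasurableSet.univ] using h

lemma continuous_testFunction (φ : testFunctions) : Continuous (φ : Torus → ℝ) := by
  have hq : IsOpenQuotientMap (fun (x : Fin 2 → ℝ) (i : Fin 2) => (x i : UnitAddCircle)) :=
    IsOpenQuotientMap.piMap fun _ => QuotientAddGroup.isOpenQuotientMap_mk
  have h : ContDiff ℝ ((⊤ : ℕ∞) : WithTop ℕ∞) (periodicLift φ) := φ.2
  exact hq.isQuotientMap.continuous_iff.2 h.continuous

instance : IsProbabilityMeasure torusMeasure := by
  unfold torusMeasure; infer_instance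

lemma IsWhiteNoise.memLp_eval (hμ : IsWhiteNoise μ) (φ : testFunctions) {p : ENNReal}
    (hp : p ≠ ⊤) : MemLp (fun ξ : PeriodicDistribution => ξ φ) p μ := by
  have h := ProbabilityTheory.memLp_id_gaussianReal' (μ := 0)
    (v := Real.toNNReal (∫ x, (φ : Torus → ℝ) x ^ 2 ∂torusMeasure)) p hp
  rw [← hμ φ] at h
  exact h.comp_of_map (measurable_eval φ).aemeasurable

lemma IsWhiteNoise.integral_sq (hμ : IsWhiteNoise μ) (φ : testFunctions) :
    ∫ ξ, ξ φ ^ 2 ∂μ = ∫ x, (φ : Torus → ℝ) x ^ 2 ∂torusMeasure := by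
  have h := ProbabilityTheory.variance_fun_id_gaussianReal (μ := 0)
    (v := Real.toNNReal (∫ x, (φ : Torus → ℝ) x ^ 2 ∂torusMeasure))
  rw [ProbabilityTheory.variance_eq_integral measurable_id'.aemeasurable] at h
  simp only [ProbabilityTheory.integral_id_gaussianReal, sub_zero] at h
  rw [Real.coe_toNNReal _ (integral_nonneg fun x => sq_nonneg _), ← hμ φ,
    integral_map (measurable_eval φ).aemeasurable (by fun_prop)] at h
  exact h

lemma IsWhiteNoise.integral_pow_four (hμ : IsWhiteNoise μ) (φ : testFunctions) :
    ∫ ξ, ξ φ ^ 4 ∂μ = 3 * (∫ ξ, ξ φ ^ 2 ∂μ) ^ 2 := by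
  have h := integral_pow_four_gaussianReal
    (Real.toNNReal (∫ x, (φ : Torus → ℝ) x ^ 2 ∂torusMeasure))
  rw [Real.coe_toNNReal _ (integral_nonneg fun x => sq_nonneg _), ← hμ φ,
    integral_map (measurable_eval φ).aemeasurable (by fun_prop)] at h
  rw [h, hμ.integral_sq]

lemma IsWhiteNoise.integrable_eval_mul_eval (hμ : IsWhiteNoise μ) (φ ψ : testFunctions) :
    Integrable (fun ξ : PeriodicDistribution => ξ φ * ξ ψ) μ :=
  (hμ.memLp_eval φ (p := 2) (by simp)).integrable_mul (hμ.memLp_eval ψ (p := 2) (by simp))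

/-- Only the law of each single `ξ(φ)` is given; covariances follow by polarisation from the
linearity of `ξ`. -/
lemma IsWhiteNoise.integral_eval_mul_eval (hμ : IsWhiteNoise μ) (φ ψ : testFunctions) :
    ∫ ξ, ξ φ * ξ ψ ∂μ = ∫ x, (φ : Torus → ℝ) x * (ψ : Torus → ℝ) x ∂torusMeasure := by
  have hp := hμ.integral_sq (φ + ψ)
  have hm := hμ.integral_sq (φ - ψ)
  have i1 : ∀ φ ψ : testFunctions, Integrable
      (fun x => (φ : Torus → ℝ) x * (ψ : Torus → ℝ) x) torusMeasure := fun φ ψ =>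
    ((continuous_testFunction φ).mul (continuous_testFunction ψ)).integrable_of_hasCompactSupport
      (HasCompactSupport.of_compactSpace _)
  have i2 := hμ.integrable_eval_mul_eval
  have e1 : ∫ ξ, ξ φ * ξ ψ ∂μ = (∫ ξ, ξ (φ + ψ) ^ 2 ∂μ - ∫ ξ, ξ (φ - ψ) ^ 2 ∂μ) / 4 := by
    rw [← integral_sub, ← integral_div]
    · congr with ξ
      rw [map_add, map_sub]
      ring
    · simpa only [sq] using i2 (φ + ψ) (φ + ψ)
    · simpa only [sq] using i2 (φ - ψ) (φ - ψ)
  rw [e1, hp, hm, ← integral_sub, ← integral_div]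
  · congr with x
    simp only [Submodule.coe_add, Submodule.coe_sub, Pi.add_apply, Pi.sub_apply]
    ring
  · simpa only [sq] using i1 (φ + ψ) (φ + ψ)
  · simpa only [sq] using i1 (φ - ψ) (φ - ψ)

lemma IsWhiteNoise.integral_sum_pow_four (hμ : IsWhiteNoise μ) (c : Fin 4 → ℝ)
    (φ : Fin 4 → testFunctions) :
    ∫ ξ, (∑ i, c i * ξ (φ i)) ^ 4 ∂μ =
      3 * (∑ i, ∑ j, c i * c j * ∫ ξ, ξ (φ i) * ξ (φ j) ∂μ) ^ 2 := by
  have h := hμ.integral_pow_four (∑ i, c i • φ i)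
  have e : ∀ ξ : PeriodicDistribution, ξ (∑ i, c i • φ i) = ∑ i, c i * ξ (φ i) := by
    intro ξ
    simp [map_sum]
  simp only [e] at h
  rw [h]
  congr 2
  have int : ∀ i j, Integrable
      (fun ξ : PeriodicDistribution => c i * ξ (φ i) * (c j * ξ (φ j))) μ := fun i j =>
    ((hμ.integrable_eval_mul_eval (φ i) (φ j)).const_mul (c i * c j)).congr
      (.of_forall fun ξ => by ring)
  simp only [sq, Finset.sum_mul_sum]
  rw [integral_finsetSum _ fun i _ => integrable_finsetSum _ fun j _ => int i j]
  congr with i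
  rw [integral_finsetSum _ fun j _ => int i j]
  congr with j
  rw [← integral_const_mul]
  congr with ξ
  ring

/-- Polarisation of the fourth moment `E X⁴ = 3 (E X²)²`, valid for every linear combination of the
`ξ(φ i)`. -/
lemma IsWhiteNoise.integral_mul_four (hμ : IsWhiteNoise μ) (φ : Fin 4 → testFunctions) :
    ∫ ξ, ξ (φ 0) * ξ (φ 1) * (ξ (φ 2) * ξ (φ 3)) ∂μ =
      (∫ ξ, ξ (φ 0) * ξ (φ 1) ∂μ) * (∫ ξ, ξ (φ 2) * ξ (φ 3) ∂μ) +
      (∫ ξ, ξ (φ 0) * ξ (φ 2) ∂μ) * (∫ ξ, ξ (φ 1) * ξ (φ 3) ∂μ) +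
      (∫ ξ, ξ (φ 0) * ξ (φ 3) ∂μ) * (∫ ξ, ξ (φ 1) * ξ (φ 2) ∂μ) := by
  have int : ∀ c : Fin 4 → ℝ, Integrable (fun ξ => (∑ i, c i * ξ (φ i)) ^ 4) μ := by
    intro c
    have h := (hμ.memLp_eval (∑ i, c i • φ i) (p := 4) (by simp)).integrable_norm_pow (p := 4)
      (by simp)
    refine h.congr (.of_forall fun ξ => ?_)
    simp only [map_sum, map_smul, smul_eq_mul, Real.norm_eq_abs]
    exact Even.pow_abs (by decide) _
  let s : Bool → ℝ := fun b => if b then 1 else -1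
  let c : Bool × Bool × Bool → Fin 4 → ℝ := fun b => ![1, s b.1, s b.2.1, s b.2.2]
  -- Summing over the signs kills every monomial except `x₀x₁x₂x₃`, which has coefficient `4! = 24`
  -- in each of the `8` fourth powers: `192 = 8 · 24`.
  have h : ∫ ξ, ξ (φ 0) * ξ (φ 1) * (ξ (φ 2) * ξ (φ 3)) ∂μ =
      (∑ b, s b.1 * s b.2.1 * s b.2.2 * ∫ ξ, (∑ i, c b i * ξ (φ i)) ^ 4 ∂μ) / 192 := by
    simp only [← integral_const_mul]
    rw [← integral_finsetSum _ fun b _ => (int (c b)).const_mul _, ← integral_div]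
    congr with ξ
    simp [c, s, Fintype.sum_prod_type, Fin.sum_univ_four]
    ring
  rw [h]
  simp only [hμ.integral_sum_pow_four]
  have sy : ∀ i j, ∫ ξ, ξ (φ i) * ξ (φ j) ∂μ = ∫ ξ, ξ (φ j) * ξ (φ i) ∂μ := by
    intro i j
    simp only [mul_comm]
  simp only [c, s, Fintype.sum_prod_type, Fin.sum_univ_four, Fintype.sum_bool]
  rw [sy 1 0, sy 2 0, sy 3 0, sy 2 1, sy 3 1, sy 3 2]
  simp
  ring

/-- The complex linear span of the random variables `ξ(φ)`. -/
def noiseSpan : Submodule ℂ (PeriodicDistribution → ℂ) :=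
  Submodule.span ℂ (Set.range fun (φ : testFunctions) (ξ : PeriodicDistribution) => (ξ φ : ℂ))

lemma IsWhiteNoise.memLp_noiseSpan (hμ : IsWhiteNoise μ) {X : PeriodicDistribution → ℂ}
    (hX : X ∈ noiseSpan) {p : ENNReal} (hp : p ≠ ⊤) : MemLp X p μ := by
  induction hX using Submodule.span_induction with
  | mem X h =>
    obtain ⟨φ, rfl⟩ := h
    exact (hμ.memLp_eval φ hp).ofReal
  | zero => exact MemLp.zero
  | add X Y _ _ hX hY => exact hX.add hY
  | smul c X _ hX => exact hX.const_smul c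

lemma measurable_noiseSpan {X : PeriodicDistribution → ℂ} (hX : X ∈ noiseSpan) :
    Measurable X := by
  induction hX using Submodule.span_induction with
  | mem X h =>
    obtain ⟨φ, rfl⟩ := h
    exact Complex.measurable_ofReal.comp (measurable_eval φ)
  | zero => exact measurable_const
  | add X Y _ _ hX hY => exact hX.add hY
  | smul c X _ hX => exact hX.const_smul c

lemma IsWhiteNoise.memLp_mul (hμ : IsWhiteNoise μ) {X Y : PeriodicDistribution → ℂ}
    (hX : X ∈ noiseSpan) (hY : Y ∈ noiseSpan) : MemLp (fun ξ => X ξ * Y ξ) 2 μ := by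
  have : ENNReal.HolderTriple 4 4 2 := ⟨by
    rw [← two_mul, show (4 : ENNReal) = 2 * 2 by norm_num,
      ENNReal.mul_inv (by simp) (by simp), ← mul_assoc,
      ENNReal.mul_inv_cancel (by simp) (by simp), one_mul]⟩
  exact (hμ.memLp_noiseSpan hY (p := 4) (by simp)).mul (hμ.memLp_noiseSpan hX (p := 4) (by simp))

lemma IsWhiteNoise.integrable_mul (hμ : IsWhiteNoise μ) {X Y : PeriodicDistribution → ℂ}
    (hX : X ∈ noiseSpan) (hY : Y ∈ noiseSpan) : Integrable (fun ξ => X ξ * Y ξ) μ :=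
  (hμ.memLp_noiseSpan hX (p := 2) (by simp)).integrable_mul
    (hμ.memLp_noiseSpan hY (p := 2) (by simp))

lemma IsWhiteNoise.integrable_mul_mul (hμ : IsWhiteNoise μ) {X Y Z W : PeriodicDistribution → ℂ}
    (hX : X ∈ noiseSpan) (hY : Y ∈ noiseSpan) (hZ : Z ∈ noiseSpan) (hW : W ∈ noiseSpan) :
    Integrable (fun ξ => X ξ * Y ξ * (Z ξ * W ξ)) μ :=
  (hμ.memLp_mul hX hY).integrable_mul (hμ.memLp_mul hZ hW)

/-- Isserlis' theorem for products of four complex linear combinations of white noise. -/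
lemma IsWhiteNoise.isserlis (hμ : IsWhiteNoise μ) {X Y Z W : PeriodicDistribution → ℂ}
    (hX : X ∈ noiseSpan) (hY : Y ∈ noiseSpan) (hZ : Z ∈ noiseSpan) (hW : W ∈ noiseSpan) :
    ∫ ξ, X ξ * Y ξ * (Z ξ * W ξ) ∂μ =
      (∫ ξ, X ξ * Y ξ ∂μ) * (∫ ξ, Z ξ * W ξ ∂μ) + (∫ ξ, X ξ * Z ξ ∂μ) * (∫ ξ, Y ξ * W ξ ∂μ) +
      (∫ ξ, X ξ * W ξ ∂μ) * (∫ ξ, Y ξ * Z ξ ∂μ) := by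
  have i2 := fun {X Y} hX hY => hμ.integrable_mul (X := X) (Y := Y) hX hY
  have i4 := fun {X Y Z W} hX hY hZ hW =>
    hμ.integrable_mul_mul (X := X) (Y := Y) (Z := Z) (W := W) hX hY hZ hW
  -- Both sides are linear in each of the four factors, so each is reduced in turn to a real
  -- variable `ξ(φ)`.
  induction hX using Submodule.span_induction with
  | zero => simp
  | add X X' mX mX' hX hX' =>
    simp only [Pi.add_apply, add_mul]
    rw [integral_add (i4 mX hY hZ hW) (i4 mX' hY hZ hW), integral_add (i2 mX hY) (i2 mX' hY),
      integral_add (i2 mX hZ) (i2 mX' hZ), integral_add (i2 mX hW) (i2 mX' hW), hX, hX']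
    ring
  | smul c X mX hX =>
    simp only [Pi.smul_apply, smul_eq_mul, mul_assoc, integral_const_mul]
    simp only [mul_assoc] at hX
    rw [hX]
    ring
  | mem X mX =>
  have mF : X ∈ noiseSpan := Submodule.subset_span mX
  obtain ⟨φ, rfl⟩ := mX
  induction hY using Submodule.span_induction with
  | zero => simp
  | add X X' mX mX' hX hX' =>
    simp only [Pi.add_apply, add_mul, mul_add]
    rw [integral_add (i4 mF mX hZ hW) (i4 mF mX' hZ hW), integral_add (i2 mF mX) (i2 mF mX'),
      integral_add (i2 mX hZ) (i2 mX' hZ), integral_add (i2 mX hW) (i2 mX' hW), hX, hX']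
    ring
  | smul c X mX hX =>
    simp only [Pi.smul_apply, smul_eq_mul, mul_assoc, mul_left_comm _ c, integral_const_mul]
    simp only [mul_assoc] at hX
    rw [hX]
    ring
  | mem X mX =>
  have mG : X ∈ noiseSpan := Submodule.subset_span mX
  obtain ⟨ψ, rfl⟩ := mX
  induction hZ using Submodule.span_induction with
  | zero => simp
  | add X X' mX mX' hX hX' =>
    simp only [Pi.add_apply, add_mul, mul_add]
    rw [integral_add (i4 mF mG mX hW) (i4 mF mG mX' hW), integral_add (i2 mX hW) (i2 mX' hW),
      integral_add (i2 mF mX) (i2 mF mX'), integral_add (i2 mG mX) (i2 mG mX'), hX, hX']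
    ring
  | smul c X mX hX =>
    simp only [Pi.smul_apply, smul_eq_mul, mul_assoc, mul_left_comm _ c, integral_const_mul]
    simp only [mul_assoc] at hX
    rw [hX]
    ring
  | mem X mX =>
  have mH : X ∈ noiseSpan := Submodule.subset_span mX
  obtain ⟨θ, rfl⟩ := mX
  induction hW using Submodule.span_induction with
  | zero => simp
  | add X X' mX mX' hX hX' =>
    simp only [Pi.add_apply, mul_add]
    rw [integral_add (i4 mF mG mH mX) (i4 mF mG mH mX'),
      integral_add (i2 mH mX) (i2 mH mX'),
      integral_add (i2 mF mX) (i2 mF mX'), integral_add (i2 mG mX) (i2 mG mX'), hX, hX']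
    ring
  | smul c X mX hX =>
    simp only [Pi.smul_apply, smul_eq_mul, mul_left_comm _ c, integral_const_mul]
    rw [hX]
    ring
  | mem X mX =>
  obtain ⟨η, rfl⟩ := mX
  have h := hμ.integral_mul_four ![φ, ψ, θ, η]
  simp only [Matrix.cons_val] at h
  simp only [← Complex.ofReal_mul, integral_complex_ofReal, ← Complex.ofReal_add]
  rw [h]

/-! ### Covariances of the Fourier coefficients of white noise. -/

lemma integral_mFourier (n : Fin 2 → ℤ) :
    ∫ x, UnitAddTorus.mFourier n x ∂torusMeasure = if n = 0 then 1 else 0 := by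
  have h := orthonormal_iff_ite.1 (UnitAddTorus.orthonormal_mFourier (d := Fin 2)) 0 n
  rw [ContinuousMap.inner_toLp] at h
  simp only [UnitAddTorus.mFourier_zero, ContinuousMap.one_apply, map_one, mul_one] at h
  simp only [eq_comm (a := n)]
  exact h

lemma cosTest_neg (n : Fin 2 → ℤ) : cosTest (-n) = cosTest n := by
  ext x
  simp [cosTest, UnitAddTorus.mFourier_neg]

lemma sinTest_neg (n : Fin 2 → ℤ) : sinTest (-n) = -sinTest n := by
  ext x
  simp [sinTest, UnitAddTorus.mFourier_neg]

lemma PeriodicDistribution.coeff_neg (ξ : PeriodicDistribution) (n : Fin 2 → ℤ) :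
    ξ.coeff (-n) = (starRingEnd ℂ) (ξ.coeff n) := by
  simp [PeriodicDistribution.coeff, cosTest_neg, sinTest_neg]

lemma coeff_mem_noiseSpan (n : Fin 2 → ℤ) : (fun ξ => ξ.coeff n) ∈ noiseSpan :=
  noiseSpan.sub_mem (Submodule.subset_span ⟨cosTest n, rfl⟩)
    (noiseSpan.smul_mem Complex.I (Submodule.subset_span ⟨sinTest n, rfl⟩))

lemma measurable_coeff (n : Fin 2 → ℤ) : Measurable (fun ξ : PeriodicDistribution => ξ.coeff n) :=
  measurable_noiseSpan (coeff_mem_noiseSpan n)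

lemma integral_sub_I_mul_mul_sub_I_mul {α : Type*} [MeasurableSpace α] {ν : Measure α}
    {a b c d : α → ℝ} (hac : Integrable (fun x => a x * c x) ν)
    (hbd : Integrable (fun x => b x * d x) ν) (had : Integrable (fun x => a x * d x) ν)
    (hbc : Integrable (fun x => b x * c x) ν) :
    ∫ x, ((a x : ℂ) - Complex.I * b x) * (c x - Complex.I * d x) ∂ν =
      ((∫ x, a x * c x ∂ν : ℝ) - (∫ x, b x * d x ∂ν : ℝ)) -
        Complex.I * ((∫ x, a x * d x ∂ν : ℝ) + (∫ x, b x * c x ∂ν : ℝ)) := by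
  simp only [← integral_complex_ofReal]
  rw [← integral_sub hac.ofReal hbd.ofReal, ← integral_add had.ofReal hbc.ofReal,
    ← integral_const_mul]
  refine Eq.trans ?_ (integral_sub (hac.ofReal.sub hbd.ofReal)
    ((had.ofReal.add hbc.ofReal).const_mul Complex.I))
  congr with x
  push_cast
  linear_combination (b x * d x : ℂ) * Complex.I_mul_I

lemma IsWhiteNoise.integral_coeff_mul_coeff (hμ : IsWhiteNoise μ) (m n : Fin 2 → ℤ) :
    ∫ ξ, ξ.coeff m * ξ.coeff n ∂μ = if m + n = 0 then 1 else 0 := by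
  -- Bilinear extension of the covariance identity to complex test functions; no conjugation enters,
  -- hence the pairing `m + n = 0`.
  have key : ∀ φ ψ φ' ψ' : testFunctions,
      ∫ ξ : PeriodicDistribution, ((ξ φ : ℂ) - Complex.I * ξ ψ) * (ξ φ' - Complex.I * ξ ψ') ∂μ =
      ∫ x, (((φ : Torus → ℝ) x : ℂ) - Complex.I * (ψ : Torus → ℝ) x) *
        ((φ' : Torus → ℝ) x - Complex.I * (ψ' : Torus → ℝ) x) ∂torusMeasure := by
    intro φ ψ φ' ψ'
    have i1 : ∀ φ ψ : testFunctions, Integrable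
        (fun x => (φ : Torus → ℝ) x * (ψ : Torus → ℝ) x) torusMeasure := fun φ ψ =>
      ((continuous_testFunction φ).mul
        (continuous_testFunction ψ)).integrable_of_hasCompactSupport
          (HasCompactSupport.of_compactSpace _)
    have i2 := hμ.integrable_eval_mul_eval
    rw [integral_sub_I_mul_mul_sub_I_mul (i1 _ _) (i1 _ _) (i1 _ _) (i1 _ _),
      integral_sub_I_mul_mul_sub_I_mul (i2 _ _) (i2 _ _) (i2 _ _) (i2 _ _)]
    simp only [hμ.integral_eval_mul_eval]
  have h := key (cosTest m) (sinTest m) (cosTest n) (sinTest n)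
  refine h.trans ?_
  simp only [← neg_eq_zero (a := m + n)]
  rw [← integral_mFourier]
  congr with x
  have e : ∀ n, (((cosTest n : Torus → ℝ) x : ℂ) - Complex.I * (sinTest n : Torus → ℝ) x) =
      UnitAddTorus.mFourier (-n) x := by
    intro n
    rw [UnitAddTorus.mFourier_neg]
    apply Complex.ext <;> simp [cosTest, sinTest]
  rw [e, e, ← UnitAddTorus.mFourier_add, neg_add]

lemma IsWhiteNoise.integral_coeff_mul_conj (hμ : IsWhiteNoise μ) (m n : Fin 2 → ℤ) :
    ∫ ξ, ξ.coeff m * (starRingEnd ℂ) (ξ.coeff n) ∂μ = if m = n then 1 else 0 := by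
  simp only [← PeriodicDistribution.coeff_neg, hμ.integral_coeff_mul_coeff,
    add_neg_eq_zero]

lemma IsWhiteNoise.integral_coeff_four (hμ : IsWhiteNoise μ) (a b c d : Fin 2 → ℤ) :
    ∫ ξ, ξ.coeff a * ξ.coeff b * (starRingEnd ℂ) (ξ.coeff c * ξ.coeff d) ∂μ =
      (if a + b = 0 then 1 else 0) * (if c + d = 0 then 1 else 0) +
      (if a = c then 1 else 0) * (if b = d then 1 else 0) +
      (if a = d then 1 else 0) * (if b = c then 1 else 0) := by
  simp only [map_mul, ← PeriodicDistribution.coeff_neg]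
  rw [hμ.isserlis (coeff_mem_noiseSpan a) (coeff_mem_noiseSpan b) (coeff_mem_noiseSpan _)
    (coeff_mem_noiseSpan _)]
  simp only [hμ.integral_coeff_mul_coeff, ← neg_add, neg_eq_zero, add_neg_eq_zero]

lemma IsWhiteNoise.integrable_coeff_four (hμ : IsWhiteNoise μ) (a b c d : Fin 2 → ℤ) :
    Integrable (fun ξ => ξ.coeff a * ξ.coeff b * (starRingEnd ℂ) (ξ.coeff c * ξ.coeff d)) μ := by
  simp only [map_mul, ← PeriodicDistribution.coeff_neg]
  exact hμ.integrable_mul_mul (coeff_mem_noiseSpan a) (coeff_mem_noiseSpan b)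
    (coeff_mem_noiseSpan _) (coeff_mem_noiseSpan _)

lemma IsWhiteNoise.integral_norm_coeff_sq (hμ : IsWhiteNoise μ) (n : Fin 2 → ℤ) :
    ∫ ξ, ‖ξ.coeff n‖ ^ 2 ∂μ = 1 := by
  have h := hμ.integral_coeff_mul_conj n n
  simp only [Complex.mul_conj, Complex.normSq_eq_norm_sq, if_true] at h
  rw [integral_complex_ofReal] at h
  exact_mod_cast h

lemma IsWhiteNoise.integrable_norm_coeff_sq (hμ : IsWhiteNoise μ) (n : Fin 2 → ℤ) :
    Integrable (fun ξ => ‖ξ.coeff n‖ ^ 2) μ :=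
  (hμ.memLp_noiseSpan (coeff_mem_noiseSpan n) (p := 2) (by simp)).integrable_norm_pow (p := 2)
    (by simp)

lemma IsWhiteNoise.lintegral_norm_coeff_sq (hμ : IsWhiteNoise μ) (n : Fin 2 → ℤ) :
    ∫⁻ ξ, ENNReal.ofReal (‖ξ.coeff n‖ ^ 2) ∂μ = 1 := by
  rw [← ofReal_integral_eq_lintegral_ofReal (hμ.integrable_norm_coeff_sq n)
    (.of_forall fun ξ => by positivity), hμ.integral_norm_coeff_sq, ENNReal.ofReal_one]

lemma IsWhiteNoise.integral_norm_coeff_sq_mul (hμ : IsWhiteNoise μ) (m n : Fin 2 → ℤ) :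
    ∫ ξ, ‖ξ.coeff m‖ ^ 2 * ‖ξ.coeff n‖ ^ 2 ∂μ =
      1 + ((if m = n then 1 else 0) + if m + n = 0 then 1 else 0) := by
  have h := hμ.integral_coeff_four m n m n
  simp only [Complex.mul_conj, Complex.normSq_eq_norm_sq, if_true, norm_mul, mul_pow] at h
  rw [integral_complex_ofReal] at h
  rw [← Complex.ofReal_inj, h]
  by_cases h1 : m = n <;> by_cases h2 : m + n = 0 <;> simp [h1, h2, eq_comm (a := n)] <;>
    split_ifs <;> norm_num

lemma IsWhiteNoise.integrable_norm_coeff_sq_mul (hμ : IsWhiteNoise μ) (m n : Fin 2 → ℤ) :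
    Integrable (fun ξ => ‖ξ.coeff m‖ ^ 2 * ‖ξ.coeff n‖ ^ 2) μ := by
  refine (hμ.integrable_coeff_four m n m n).norm.congr (.of_forall fun ξ => ?_)
  simp only [norm_mul, RCLike.norm_conj]
  ring

/-! ### Convergence and divergence of weighted series in the noise coefficients. -/

lemma IsWhiteNoise.ae_summable (hμ : IsWhiteNoise μ) {c : (Fin 2 → ℤ) → ℝ} (hc : ∀ n, 0 ≤ c n)
    (hs : Summable c) : ∀ᵐ ξ ∂μ, Summable fun n => c n * ‖ξ.coeff n‖ ^ 2 := by
  have h : ∫⁻ ξ, ∑' n, ENNReal.ofReal (c n * ‖ξ.coeff n‖ ^ 2) ∂μ ≠ ⊤ := by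
    rw [lintegral_tsum fun n =>
      (((measurable_coeff n).norm.pow_const 2).const_mul (c n)).ennreal_ofReal.aemeasurable]
    have e : ∀ n, ∫⁻ ξ, ENNReal.ofReal (c n * ‖ξ.coeff n‖ ^ 2) ∂μ = ENNReal.ofReal (c n) := by
      intro n
      simp only [ENNReal.ofReal_mul (hc n)]
      rw [lintegral_const_mul _ ((measurable_coeff n).norm.pow_const 2).ennreal_ofReal,
        hμ.lintegral_norm_coeff_sq, mul_one]
    simp only [e]
    exact hs.tsum_ofReal_ne_top
  have hm : Measurable fun ξ : PeriodicDistribution =>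
      ∑' n, ENNReal.ofReal (c n * ‖ξ.coeff n‖ ^ 2) :=
    Measurable.tsum fun n =>
      (((measurable_coeff n).norm.pow_const 2).const_mul (c n)).ennreal_ofReal
  filter_upwards [ae_lt_top hm h] with ξ hξ
  have := ENNReal.summable_toReal hξ.ne
  refine this.congr fun n => ?_
  rw [ENNReal.toReal_ofReal (mul_nonneg (hc n) (by positivity))]

/-- The variables `|ξ̂(m)|²` and `|ξ̂(n)|²` are uncorrelated unless `n = ±m`, so each row of the
double sum has at most two terms. The bound does not depend on `F`. -/
lemma IsWhiteNoise.variance_sum_le (hμ : IsWhiteNoise μ) {c : (Fin 2 → ℤ) → ℝ}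
    (hs : Summable fun n => c n ^ 2) (F : Finset (Fin 2 → ℤ)) :
    ProbabilityTheory.variance (fun ξ => ∑ n ∈ F, c n * ‖ξ.coeff n‖ ^ 2) μ ≤
      2 * ∑' n, c n ^ 2 := by
  have := hμ.isProbabilityMeasure
  have hm : AEMeasurable (fun ξ : PeriodicDistribution => ∑ n ∈ F, c n * ‖ξ.coeff n‖ ^ 2) μ :=
    (Finset.measurable_sum _ fun n _ =>
      ((measurable_coeff n).norm.pow_const 2).const_mul (c n)).aemeasurable
  have hE : ∫ ξ, ∑ n ∈ F, c n * ‖ξ.coeff n‖ ^ 2 ∂μ = ∑ n ∈ F, c n := by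
    rw [integral_finsetSum _ fun n _ => (hμ.integrable_norm_coeff_sq n).const_mul _]
    simp only [integral_const_mul, hμ.integral_norm_coeff_sq, mul_one]
  have hint : ∀ m n, Integrable (fun ξ =>
      c m * c n * (‖ξ.coeff m‖ ^ 2 * ‖ξ.coeff n‖ ^ 2 - ‖ξ.coeff m‖ ^ 2 - ‖ξ.coeff n‖ ^ 2 + 1)) μ :=
    fun m n => ((((hμ.integrable_norm_coeff_sq_mul m n).sub (hμ.integrable_norm_coeff_sq m)).sub
      (hμ.integrable_norm_coeff_sq n)).add (integrable_const 1)).const_mul _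
  have hval : ∀ m n, ∫ ξ,
      c m * c n * (‖ξ.coeff m‖ ^ 2 * ‖ξ.coeff n‖ ^ 2 - ‖ξ.coeff m‖ ^ 2 - ‖ξ.coeff n‖ ^ 2 + 1) ∂μ =
      c m * c n * ((if m = n then 1 else 0) + if m + n = 0 then 1 else 0) := by
    intro m n
    rw [integral_const_mul]
    congr 1
    have h1 := integral_add (μ := μ) (((hμ.integrable_norm_coeff_sq_mul m n).sub
      (hμ.integrable_norm_coeff_sq m)).sub (hμ.integrable_norm_coeff_sq n)) (integrable_const 1)
    have h2 := integral_sub (μ := μ) ((hμ.integrable_norm_coeff_sq_mul m n).sub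
      (hμ.integrable_norm_coeff_sq m)) (hμ.integrable_norm_coeff_sq n)
    have h3 := integral_sub (μ := μ) (hμ.integrable_norm_coeff_sq_mul m n)
      (hμ.integrable_norm_coeff_sq m)
    simp only [Pi.sub_apply] at h1 h2
    rw [h1, h2, h3, hμ.integral_norm_coeff_sq, hμ.integral_norm_coeff_sq,
      hμ.integral_norm_coeff_sq_mul]
    simp
  rw [ProbabilityTheory.variance_eq_integral hm, hE]
  have e : ∀ ξ : PeriodicDistribution, (∑ n ∈ F, c n * ‖ξ.coeff n‖ ^ 2 - ∑ n ∈ F, c n) ^ 2 =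
      ∑ m ∈ F, ∑ n ∈ F, c m * c n *
        (‖ξ.coeff m‖ ^ 2 * ‖ξ.coeff n‖ ^ 2 - ‖ξ.coeff m‖ ^ 2 - ‖ξ.coeff n‖ ^ 2 + 1) := by
    intro ξ
    rw [← Finset.sum_sub_distrib, sq, Finset.sum_mul_sum]
    refine Finset.sum_congr rfl fun m _ => Finset.sum_congr rfl fun n _ => ?_
    ring
  simp only [e]
  rw [integral_finsetSum _ fun m _ => integrable_finsetSum _ fun n _ => hint m n]
  have hrow : ∀ m ∈ F, ∫ ξ, ∑ n ∈ F, c m * c n *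
        (‖ξ.coeff m‖ ^ 2 * ‖ξ.coeff n‖ ^ 2 - ‖ξ.coeff m‖ ^ 2 - ‖ξ.coeff n‖ ^ 2 + 1) ∂μ ≤
      c m ^ 2 + (c m ^ 2 + c (-m) ^ 2) / 2 := by
    intro m hm
    rw [integral_finsetSum _ fun n _ => hint m n]
    simp only [hval]
    simp only [mul_add, Finset.sum_add_distrib, mul_ite, mul_one, mul_zero]
    simp only [add_comm m, add_eq_zero_iff_eq_neg, Finset.sum_ite_eq, Finset.sum_ite_eq', hm,
      if_true]
    split_ifs <;> nlinarith [sq_nonneg (c m - c (-m)), sq_nonneg (c m), sq_nonneg (c (-m))]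
  refine (Finset.sum_le_sum hrow).trans ?_
  rw [Finset.sum_add_distrib, ← Finset.sum_div, Finset.sum_add_distrib]
  have hneg : Summable fun n => c (-n) ^ 2 := (Equiv.neg (Fin 2 → ℤ)).summable_iff.2 hs
  have h1 := hs.sum_le_tsum F fun n _ => sq_nonneg _
  have h2 := hneg.sum_le_tsum F fun n _ => sq_nonneg _
  have h3 : ∑' n, c (-n) ^ 2 = ∑' n, c n ^ 2 :=
    (Equiv.neg (Fin 2 → ℤ)).tsum_eq fun n => c n ^ 2
  linarith

lemma IsWhiteNoise.ae_tsum_eq_top (hμ : IsWhiteNoise μ) {c : (Fin 2 → ℤ) → ℝ}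
    (hc : ∀ n, 0 ≤ c n) (hns : ¬ Summable c) (hs : Summable fun n => c n ^ 2) :
    ∀ᵐ ξ ∂μ, ∑' n, ENNReal.ofReal (c n * ‖ξ.coeff n‖ ^ 2) = ⊤ := by
  have := hμ.isProbabilityMeasure
  set V : ℝ := 2 * ∑' n, c n ^ 2 with hV
  have key : ∀ M : ℕ, ∀ᵐ ξ ∂μ, (M : ENNReal) ≤ ∑' n, ENNReal.ofReal (c n * ‖ξ.coeff n‖ ^ 2) := by
    intro M
    rw [ae_iff]
    refine le_antisymm (ENNReal.le_of_forall_pos_le_add fun ε hε _ => ?_) zero_le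
    rw [zero_add]
    -- Chebyshev will bound the probability of a deviation by `R` by `V / R²`. As the mean over `F`
    -- is taken to be at least `M + R`, falling below `M` is such a deviation.
    obtain ⟨R, hR0, hR⟩ : ∃ R : ℝ, 0 < R ∧ V / R ^ 2 ≤ ε := by
      refine ⟨V / ε + 1, ?_, ?_⟩
      · have : 0 ≤ V := mul_nonneg zero_le_two (tsum_nonneg fun n => sq_nonneg _)
        positivity
      · have hV0 : 0 ≤ V := mul_nonneg zero_le_two (tsum_nonneg fun n => sq_nonneg _)
        have hε' : (0 : ℝ) < ε := hε
        rw [div_le_iff₀ (by positivity)]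
        have : V = ε * (V / ε) := by field_simp
        have h2 : 0 ≤ V / ε := by positivity
        nlinarith [sq_nonneg (V / ε)]
    obtain ⟨F, hF⟩ : ∃ F : Finset (Fin 2 → ℤ), M + R ≤ ∑ n ∈ F, c n := by
      by_contra! h
      exact hns (summable_of_sum_le hc fun F => (h F).le)
    have hmem : MemLp (fun ξ : PeriodicDistribution => ∑ n ∈ F, c n * ‖ξ.coeff n‖ ^ 2) 2 μ := by
      refine memLp_finsetSum _ fun n _ => MemLp.const_mul ?_ _
      refine MemLp.congr_norm (hμ.memLp_mul (coeff_mem_noiseSpan n) (coeff_mem_noiseSpan n))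
        ((measurable_coeff n).norm.pow_const 2).aestronglyMeasurable (.of_forall fun ξ => ?_)
      simp [sq]
    have hE : ∫ ξ, ∑ n ∈ F, c n * ‖ξ.coeff n‖ ^ 2 ∂μ = ∑ n ∈ F, c n := by
      rw [integral_finsetSum _ fun n _ => (hμ.integrable_norm_coeff_sq n).const_mul _]
      simp only [integral_const_mul, hμ.integral_norm_coeff_sq, mul_one]
    have hch := ProbabilityTheory.meas_ge_le_variance_div_sq hmem hR0
    refine (measure_mono fun ξ hξ => ?_).trans (hch.trans ?_)
    · simp only [Set.mem_ofPred_eq, not_le] at hξ ⊢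
      rw [hE]
      have h1 : ENNReal.ofReal (∑ n ∈ F, c n * ‖ξ.coeff n‖ ^ 2) < M := by
        rw [ENNReal.ofReal_sum_of_nonneg fun n _ => mul_nonneg (hc n) (by positivity)]
        exact (ENNReal.sum_le_tsum F).trans_lt hξ
      rw [← ENNReal.ofReal_natCast, ENNReal.ofReal_lt_ofReal_iff_of_nonneg
        (Finset.sum_nonneg fun n _ => mul_nonneg (hc n) (by positivity))] at h1
      rw [abs_sub_comm]
      exact (by linarith : R ≤ _).trans (le_abs_self _)
    · rw [← ENNReal.ofReal_coe_nnreal]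
      exact ENNReal.ofReal_le_ofReal
        ((div_le_div_of_nonneg_right (hμ.variance_sum_le hs F) (by positivity)).trans hR)
  filter_upwards [ae_all_iff.2 key] with ξ hξ
  exact ENNReal.eq_top_of_forall_nnreal_le fun r => by
    obtain ⟨M, hM⟩ := exists_nat_ge r
    exact le_trans (by exact_mod_cast hM) (hξ M)

/-- For `k ≠ 0` the pairing of `m` with `k - m` vanishes, so Isserlis leaves only `n = m` and `n = k
- m`. The second is dominated using `2 aₘ aₙ ≤ aₘ² + aₙ²`. Uniformity in `F` is what Fatou's lemma
needs later. -/
lemma IsWhiteNoise.lintegral_sum_sq_le (hμ : IsWhiteNoise μ) (a : (Fin 2 → ℤ) → ℝ)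
    {k : Fin 2 → ℤ} (hk : k ≠ 0) (F : Finset (Fin 2 → ℤ)) :
    ∫⁻ ξ, ENNReal.ofReal (‖∑ m ∈ F, a m * (ξ.coeff m * ξ.coeff (k - m))‖ ^ 2) ∂μ ≤
      ENNReal.ofReal (2 * ∑ m ∈ F, a m ^ 2) := by
  have hint : ∀ m n, Integrable (fun ξ => (a m * a n : ℂ) * (ξ.coeff m * ξ.coeff (k - m) *
      (starRingEnd ℂ) (ξ.coeff n * ξ.coeff (k - n)))) μ := fun m n =>
    (hμ.integrable_coeff_four m (k - m) n (k - n)).const_mul _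
  have hexp : ∀ ξ : PeriodicDistribution,
      ((‖∑ m ∈ F, a m * (ξ.coeff m * ξ.coeff (k - m))‖ ^ 2 : ℝ) : ℂ) =
      ∑ m ∈ F, ∑ n ∈ F, (a m * a n : ℂ) * (ξ.coeff m * ξ.coeff (k - m) *
      (starRingEnd ℂ) (ξ.coeff n * ξ.coeff (k - n))) := by
    intro ξ
    rw [← Complex.normSq_eq_norm_sq, ← Complex.mul_conj, map_sum, Finset.sum_mul_sum]
    refine Finset.sum_congr rfl fun m _ => Finset.sum_congr rfl fun n _ => ?_
    simp only [map_mul, Complex.conj_ofReal]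
    ring
  have hI : Integrable
      (fun ξ : PeriodicDistribution => ‖∑ m ∈ F, a m * (ξ.coeff m * ξ.coeff (k - m))‖ ^ 2) μ := by
    have h : Integrable (fun ξ => ∑ m ∈ F, ∑ n ∈ F, (a m * a n : ℂ) *
        (ξ.coeff m * ξ.coeff (k - m) * (starRingEnd ℂ) (ξ.coeff n * ξ.coeff (k - n)))) μ :=
      integrable_finsetSum _ fun m _ => integrable_finsetSum _ fun n _ => hint m n
    refine h.re.congr (.of_forall fun ξ => ?_)
    simp only [← hexp]
    exact Complex.ofReal_re _
  rw [← ofReal_integral_eq_lintegral_ofReal hI (.of_forall fun ξ => by positivity)]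
  refine ENNReal.ofReal_le_ofReal ?_
  have hval : ∫ ξ, ‖∑ m ∈ F, a m * (ξ.coeff m * ξ.coeff (k - m))‖ ^ 2 ∂μ =
      ∑ m ∈ F, ∑ n ∈ F, a m * a n * ((if m = n then 1 else 0) + if m = k - n then 1 else 0) := by
    rw [← Complex.ofReal_inj, ← integral_complex_ofReal]
    simp only [hexp]
    rw [integral_finsetSum _ fun m _ => integrable_finsetSum _ fun n _ => hint m n]
    push_cast
    refine Finset.sum_congr rfl fun m _ => ?_
    rw [integral_finsetSum _ fun n _ => hint m n]
    refine Finset.sum_congr rfl fun n _ => ?_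
    rw [integral_const_mul, hμ.integral_coeff_four]
    have h1 : m + (k - m) ≠ 0 := by simpa using hk
    have h2 : k - m = n ↔ m = k - n := by
      constructor <;> rintro rfl <;> simp
    simp only [h1, if_false, zero_mul, zero_add, sub_right_inj, h2]
    congr 1
    split_ifs <;> simp
  rw [hval]
  calc ∑ m ∈ F, ∑ n ∈ F, a m * a n * ((if m = n then 1 else 0) + if m = k - n then 1 else 0)
      ≤ ∑ m ∈ F, ∑ n ∈ F, ((if m = n then a m ^ 2 else 0) +
          ((if n = k - m then a m ^ 2 / 2 else 0) + if m = k - n then a n ^ 2 / 2 else 0)) := by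
        refine Finset.sum_le_sum fun m _ => Finset.sum_le_sum fun n _ => ?_
        have h2 : n = k - m ↔ m = k - n := by
          constructor <;> rintro rfl <;> simp
        simp only [h2]
        have := two_mul_le_add_sq (a m) (a n)
        split_ifs with h h' h'
        · subst h; nlinarith
        · subst h; nlinarith
        · nlinarith
        · nlinarith
    _ ≤ 2 * ∑ m ∈ F, a m ^ 2 := by
        simp only [Finset.sum_add_distrib]
        rw [Finset.sum_comm (f := fun m n => if m = k - n then a n ^ 2 / 2 else 0)]
        simp only [Finset.sum_ite_eq, Finset.sum_ite_eq']
        rw [Finset.mul_sum, ← Finset.sum_add_distrib, ← Finset.sum_add_distrib]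
        refine Finset.sum_le_sum fun m hm => ?_
        simp only [hm, if_true]
        split_ifs <;> nlinarith [sq_nonneg (a m)]

/-! ### Lattice sums of the symbol. -/

lemma symbolL_nonneg (n : Fin 2 → ℤ) : 0 ≤ symbolL n := by
  unfold symbolL
  positivity

lemma symbolL_neg (n : Fin 2 → ℤ) : symbolL (-n) = symbolL n := by
  simp [symbolL, wave]

/-- With the convention `0⁻¹ = 0` also `σ⁻¹ = 0` on these modes, so multiplication by `σ⁻¹` includes
the projection `P` and sums may run over all of `ℤ²`. -/
lemma symbolL_eq_zero {n : Fin 2 → ℤ} (h : n 0 = 0) : symbolL n = 0 := by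
  simp [symbolL, wave, h]

lemma symbolL_pos {n : Fin 2 → ℤ} (h : n 0 ≠ 0) : 0 < symbolL n := by
  have : wave n 0 ≠ 0 := by
    simp [wave, h, Real.pi_ne_zero]
  unfold symbolL
  positivity

lemma abs_wave (n : Fin 2 → ℤ) (i : Fin 2) : |wave n i| = 2 * Real.pi * |(n i : ℝ)| := by
  rw [wave, abs_mul, abs_of_pos Real.two_pi_pos]

lemma one_le_abs_cast {a : ℤ} (h : a ≠ 0) : (1 : ℝ) ≤ |(a : ℝ)| := by
  exact_mod_cast Int.one_le_abs h

lemma symbolL_eq (n : Fin 2 → ℤ) : symbolL n =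
    (2 * Real.pi) ^ 2 * |(n 0 : ℝ)| ^ 2 + 2 * Real.pi * (|(n 1 : ℝ)| ^ 2 / |(n 0 : ℝ)|) := by
  have hp := Real.pi_ne_zero
  rw [symbolL, abs_wave, sq_abs, sq_abs, wave, wave]
  by_cases h : n 0 = 0
  · simp [h]
  · have : |(n 0 : ℝ)| ≠ 0 := by simpa using h
    field_simp

lemma le_symbolL (n : Fin 2 → ℤ) :
    |(n 0 : ℝ)| ^ 2 + |(n 1 : ℝ)| ^ 2 / |(n 0 : ℝ)| ≤ symbolL n := by
  rw [symbolL_eq]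
  have hp := Real.pi_gt_three
  have h1 : 1 ≤ (2 * Real.pi) ^ 2 := by nlinarith
  have h2 : 1 ≤ 2 * Real.pi := by linarith
  have h3 : 0 ≤ |(n 1 : ℝ)| ^ 2 / |(n 0 : ℝ)| := by positivity
  nlinarith [sq_nonneg (|(n 0 : ℝ)|)]

/-- Splits the square as `2 = 1.4 + 0.6`, using `A²` for one power and `B²/A` for the other. The
exponents are tuned so that `A σ⁻² ≤ A^{-1.2} B^{-1.2}`, summable in both variables. -/
lemma rpow_mul_rpow_le_sq {A B : ℝ} (hA : 0 < A) (hB : 0 ≤ B) :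
    A ^ (2.2 : ℝ) * B ^ (1.2 : ℝ) ≤ (A ^ 2 + B ^ 2 / A) ^ 2 := by
  set t := A ^ 2 + B ^ 2 / A
  have ht : 0 < t := by positivity
  have h1 : A ^ (2.8 : ℝ) ≤ t ^ (1.4 : ℝ) := by
    rw [show (2.8 : ℝ) = (2 : ℕ) * 1.4 by norm_num, Real.rpow_natCast_mul hA.le]
    exact Real.rpow_le_rpow (by positivity) (le_add_of_nonneg_right (by positivity)) (by norm_num)
  have h2 : B ^ (1.2 : ℝ) / A ^ (0.6 : ℝ) ≤ t ^ (0.6 : ℝ) := by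
    rw [show (1.2 : ℝ) = (2 : ℕ) * 0.6 by norm_num, Real.rpow_natCast_mul hB,
      ← Real.div_rpow (by positivity) hA.le]
    exact Real.rpow_le_rpow (by positivity) (le_add_of_nonneg_left (by positivity)) (by norm_num)
  calc A ^ (2.2 : ℝ) * B ^ (1.2 : ℝ) = A ^ (2.8 : ℝ) * (B ^ (1.2 : ℝ) / A ^ (0.6 : ℝ)) := by
        rw [show (2.8 : ℝ) = 2.2 + 0.6 by norm_num, Real.rpow_add hA]
        field_simp
    _ ≤ t ^ (1.4 : ℝ) * t ^ (0.6 : ℝ) := by gcongr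
    _ = t ^ 2 := by
        rw [← Real.rpow_add ht, ← Real.rpow_natCast]
        norm_num

/-- A summable majorant on `ℤ`, equal to `|b|^{-6/5}` off the origin. -/
def intWeight (b : ℤ) : ℝ := |(b : ℝ)| ^ (-1.2 : ℝ) + if b = 0 then 1 else 0

lemma intWeight_nonneg (b : ℤ) : 0 ≤ intWeight b := by
  unfold intWeight
  positivity

lemma summable_intWeight : Summable intWeight :=
  (Real.summable_abs_int_rpow (by norm_num)).add (hasSum_ite_eq 0 1).summable

lemma abs_wave_mul_inv_symbolL_sq_le (n : Fin 2 → ℤ) :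
    |wave n 0| * (symbolL n)⁻¹ ^ 2 ≤ 2 * Real.pi * (intWeight (n 0) * intWeight (n 1)) := by
  by_cases h : n 0 = 0
  · rw [symbolL_eq_zero h]
    have := Real.pi_pos
    simp only [inv_zero, ne_eq, OfNat.ofNat_ne_zero, not_false_eq_true, zero_pow, mul_zero]
    exact mul_nonneg (by positivity) (mul_nonneg (intWeight_nonneg _) (intWeight_nonneg _))
  have hA := one_le_abs_cast h
  rw [abs_wave, mul_assoc]
  refine mul_le_mul_of_nonneg_left ?_ (by positivity)
  have hle := le_symbolL n
  simp only [intWeight, h, if_false, add_zero]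
  set A := |(n 0 : ℝ)|
  set B := |(n 1 : ℝ)| with hBdef
  have hA0 : 0 < A := by linarith
  have hσ := symbolL_pos h
  have hsq : (A ^ 2 + B ^ 2 / A) ^ 2 ≤ symbolL n ^ 2 :=
    pow_le_pow_left₀ (by positivity) hle 2
  have hrw : A * (symbolL n)⁻¹ ^ 2 = A / symbolL n ^ 2 := by
    rw [inv_pow, div_eq_mul_inv]
  rw [hrw, div_le_iff₀ (by positivity)]
  have hA22 : A ^ (-1.2 : ℝ) * A ^ (2.2 : ℝ) = A := by
    rw [← Real.rpow_add hA0]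
    norm_num
  by_cases hb : n 1 = 0
  · have hB : B = 0 := by simp [hBdef, hb]
    simp only [hb, if_true, hB]
    rw [Real.zero_rpow (by norm_num), zero_add, mul_one]
    calc A = A ^ (-1.2 : ℝ) * A ^ (2.2 : ℝ) := hA22.symm
      _ ≤ A ^ (-1.2 : ℝ) * A ^ ((4 : ℕ) : ℝ) := by
        gcongr
        norm_num
      _ ≤ A ^ (-1.2 : ℝ) * symbolL n ^ 2 := by
        gcongr
        rw [Real.rpow_natCast]
        simp only [hB] at hsq
        norm_num at hsq
        nlinarith
  · have hB : 1 ≤ B := one_le_abs_cast hb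
    simp only [hb, if_false, add_zero]
    have hB0 : 0 < B := by linarith
    have hB12 : B ^ (-1.2 : ℝ) * B ^ (1.2 : ℝ) = 1 := by
      rw [← Real.rpow_add hB0]
      norm_num
    calc A = (A ^ (-1.2 : ℝ) * A ^ (2.2 : ℝ)) * (B ^ (-1.2 : ℝ) * B ^ (1.2 : ℝ)) := by
          rw [hA22, hB12, mul_one]
      _ = A ^ (-1.2 : ℝ) * B ^ (-1.2 : ℝ) * (A ^ (2.2 : ℝ) * B ^ (1.2 : ℝ)) := by ring
      _ ≤ _ := by
        gcongr
        exact (rpow_mul_rpow_le_sq hA0 hB0.le).trans hsq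

lemma summable_abs_wave_mul_inv_symbolL_sq :
    Summable fun n : Fin 2 → ℤ => |wave n 0| * (symbolL n)⁻¹ ^ 2 := by
  have h := summable_intWeight.mul_of_nonneg summable_intWeight intWeight_nonneg intWeight_nonneg
  have h' := ((finTwoArrowEquiv ℤ).summable_iff.2 h).mul_left (2 * Real.pi)
  exact h'.of_nonneg_of_le (fun n => by positivity) abs_wave_mul_inv_symbolL_sq_le

lemma summable_inv_symbolL_sq : Summable fun n : Fin 2 → ℤ => (symbolL n)⁻¹ ^ 2 := by
  refine summable_abs_wave_mul_inv_symbolL_sq.of_nonneg_of_le (fun n => by positivity) fun n => ?_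
  by_cases h : n 0 = 0
  · simp [symbolL_eq_zero h]
  · refine le_mul_of_one_le_left (by positivity) ?_
    rw [abs_wave]
    nlinarith [one_le_abs_cast h, Real.pi_gt_three]

/-- On the cone `0 ≤ n₂ < n₁` the symbol is at most a multiple of `n₁²`, so the `n₁` terms with
given `n₁` contribute at least a multiple of `1/n₁`: the harmonic series. -/
lemma not_summable_inv_symbolL : ¬ Summable fun n : Fin 2 → ℤ => (symbolL n)⁻¹ := by
  intro h
  have hinj : Function.Injective fun p : ℕ × ℕ => (![(p.1 : ℤ) + 1, (p.2 : ℤ)] : Fin 2 → ℤ) := by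
    intro p q hpq
    have h0 := congrFun hpq 0
    have h1 := congrFun hpq 1
    simp at h0 h1
    exact Prod.ext h0 h1
  have h2 : Summable fun p : ℕ × ℕ => (symbolL ![(p.1 : ℤ) + 1, (p.2 : ℤ)])⁻¹ :=
    h.comp_injective hinj
  have h3 := h2.prod
  -- The constant `80` leaves room above `(2π)² + 2π`, bounded via `π < 4` by `64 + 8`.
  have hbd : ∀ p q : ℕ, q ∈ Finset.range (p + 1) →
      (80 * ((p : ℝ) + 1) ^ 2)⁻¹ ≤ (symbolL ![(p : ℤ) + 1, (q : ℤ)])⁻¹ := by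
    intro p q hq
    have hq' : (q : ℝ) ≤ p + 1 := by
      exact_mod_cast (Finset.mem_range.1 hq).le
    refine inv_anti₀ (symbolL_pos (by simp; omega)) ?_
    rw [symbolL_eq]
    simp only [Matrix.cons_val_zero, Matrix.cons_val_one, Int.cast_add, Int.cast_natCast,
      Int.cast_one]
    have hp0 : (0 : ℝ) ≤ p := p.cast_nonneg
    have hq0 : (0 : ℝ) ≤ q := q.cast_nonneg
    rw [abs_of_nonneg (by positivity : (0 : ℝ) ≤ p + 1), abs_of_nonneg hq0]
    have h1 : (q : ℝ) ^ 2 / (p + 1) ≤ (p + 1) ^ 2 := by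
      rw [div_le_iff₀ (by positivity)]
      have : (q : ℝ) ^ 2 ≤ (p + 1) ^ 2 := by gcongr
      nlinarith [sq_nonneg ((p : ℝ) + 1)]
    have hpi := Real.pi_lt_four
    have hpi' := Real.pi_gt_three
    have h4 : (2 * Real.pi) ^ 2 ≤ 64 := by nlinarith
    have h5 : 0 ≤ (q : ℝ) ^ 2 / (p + 1) := by positivity
    nlinarith [sq_nonneg ((p : ℝ) + 1)]
  have h4 : Summable fun p : ℕ => (80 : ℝ)⁻¹ * (1 / ((p : ℝ) + 1)) := by
    refine h3.of_nonneg_of_le (fun p => by positivity) fun p => ?_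
    have h5 := (h2.prod_factor p).sum_le_tsum (Finset.range (p + 1))
      fun q _ => inv_nonneg.2 (symbolL_nonneg _)
    refine le_trans ?_ h5
    refine le_trans (le_of_eq ?_) (Finset.sum_le_sum (hbd p))
    rw [Finset.sum_const, Finset.card_range, nsmul_eq_mul]
    push_cast
    field_simp
  rw [summable_mul_left_iff (by norm_num)] at h4
  refine Real.not_summable_one_div_natCast ((summable_nat_add_iff 1).1 ?_)
  simpa using h4

lemma tsum_tsum_mul_sub (P Q : (Fin 2 → ℤ) → ENNReal) :
    ∑' k, ∑' m, P m * Q (k - m) = (∑' m, P m) * ∑' m, Q m := by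
  rw [ENNReal.tsum_comm, ← ENNReal.tsum_mul_right]
  congr with m
  rw [ENNReal.tsum_mul_left]
  congr 1
  exact (Equiv.subRight m).tsum_eq Q

lemma tsum_abs_wave_mul_tsum_sq_lt_top :
    ∑' k : Fin 2 → ℤ, ENNReal.ofReal |wave k 0| *
      ∑' m, ENNReal.ofReal (2 * ((symbolL m)⁻¹ * (symbolL (k - m))⁻¹) ^ 2) < ⊤ := by
  set P : (Fin 2 → ℤ) → ENNReal := fun n => ENNReal.ofReal (|wave n 0| * (symbolL n)⁻¹ ^ 2)
    with hP
  set Q : (Fin 2 → ℤ) → ENNReal := fun n => ENNReal.ofReal ((symbolL n)⁻¹ ^ 2) with hQ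
  have hle : ∀ k m, ENNReal.ofReal |wave k 0| *
      ENNReal.ofReal (2 * ((symbolL m)⁻¹ * (symbolL (k - m))⁻¹) ^ 2) ≤
      2 * (P m * Q (k - m) + Q m * P (k - m)) := by
    intro k m
    have h2 : (2 : ENNReal) = ENNReal.ofReal 2 := by norm_num
    rw [hP, hQ, h2, ← ENNReal.ofReal_mul (by positivity), ← ENNReal.ofReal_mul (by positivity),
      ← ENNReal.ofReal_mul (by positivity), ← ENNReal.ofReal_add (by positivity) (by positivity),
      ← ENNReal.ofReal_mul (by positivity)]
    refine ENNReal.ofReal_le_ofReal ?_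
    have h : |wave k 0| ≤ |wave m 0| + |wave (k - m) 0| := by
      have e : wave k 0 = wave m 0 + wave (k - m) 0 := by
        simp only [wave, Pi.sub_apply, Int.cast_sub]
        ring
      rw [e]
      exact abs_add_le _ _
    have h0 : 0 ≤ (symbolL m)⁻¹ ^ 2 * (symbolL (k - m))⁻¹ ^ 2 := by positivity
    nlinarith [mul_le_mul_of_nonneg_right h h0]
  simp only [← ENNReal.tsum_mul_left]
  refine (ENNReal.tsum_le_tsum fun k => ENNReal.tsum_le_tsum fun m => hle k m).trans_lt ?_
  simp only [ENNReal.tsum_mul_left, ENNReal.tsum_add]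
  rw [tsum_tsum_mul_sub, tsum_tsum_mul_sub]
  have hPt : ∑' n, P n < ⊤ := summable_abs_wave_mul_inv_symbolL_sq.tsum_ofReal_lt_top
  have hQt : ∑' n, Q n < ⊤ := summable_inv_symbolL_sq.tsum_ofReal_lt_top
  exact ENNReal.mul_lt_top (by simp) (ENNReal.add_lt_top.2
    ⟨ENNReal.mul_lt_top hPt hQt, ENNReal.mul_lt_top hQt hPt⟩)

/-- The null set must not depend on `c`, which will be built from the coefficients of `v²`. So the
liminf of partial sums along a fixed exhaustion is estimated by Fatou; it equals `‖c k‖²` whenever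
the series converges. -/
lemma IsWhiteNoise.ae_tsum_convolution_lt_top (hμ : IsWhiteNoise μ) :
    ∀ᵐ ξ ∂μ, ∀ c : (Fin 2 → ℤ) → ℂ,
      (∀ k, HasSum (fun m => (((symbolL m)⁻¹ * (symbolL (k - m))⁻¹ : ℝ) : ℂ) *
        (ξ.coeff m * ξ.coeff (k - m))) (c k)) →
      ∑' k, ENNReal.ofReal |wave k 0| * ENNReal.ofReal (‖c k‖ ^ 2) < ⊤ := by
  obtain ⟨F, hF⟩ := Filter.exists_seq_tendsto (Filter.atTop : Filter (Finset (Fin 2 → ℤ)))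
  set S : (Fin 2 → ℤ) → ℕ → PeriodicDistribution → ENNReal := fun k N ξ =>
    ENNReal.ofReal (‖∑ m ∈ F N, (((symbolL m)⁻¹ * (symbolL (k - m))⁻¹ : ℝ) : ℂ) *
        (ξ.coeff m * ξ.coeff (k - m))‖ ^ 2) with hS
  have hSm : ∀ k N, Measurable (S k N) := fun k N =>
    ((Finset.measurable_sum _ fun m _ => ((measurable_coeff m).mul
      (measurable_coeff (k - m))).const_mul _).norm.pow_const 2).ennreal_ofReal
  have hGm : ∀ k, Measurable fun ξ => Filter.liminf (fun N => S k N ξ) Filter.atTop :=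
    fun k => Measurable.liminf (hSm k)
  have hT : ∫⁻ ξ, ∑' k, ENNReal.ofReal |wave k 0| *
      Filter.liminf (fun N => S k N ξ) Filter.atTop ∂μ ≠ ⊤ := by
    rw [lintegral_tsum fun k => ((hGm k).const_mul _).aemeasurable]
    refine (lt_of_le_of_lt (ENNReal.tsum_le_tsum fun k => ?_) tsum_abs_wave_mul_tsum_sq_lt_top).ne
    rw [lintegral_const_mul _ (hGm k)]
    -- The second-moment bound fails at `k = 0`, but the weight `|k₁|` vanishes there.
    by_cases hk : k = 0
    · simp [hk, wave]
    gcongr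
    refine (lintegral_liminf_le (hSm k)).trans ?_
    refine Filter.liminf_le_of_le (by isBoundedDefault) fun b hb => ?_
    obtain ⟨N, hN⟩ := hb.exists
    refine hN.trans ((hμ.lintegral_sum_sq_le _ hk (F N)).trans ?_)
    rw [Finset.mul_sum, ENNReal.ofReal_sum_of_nonneg fun m _ => by positivity]
    exact ENNReal.sum_le_tsum _
  filter_upwards [ae_lt_top (Measurable.tsum fun k => (hGm k).const_mul _) hT] with ξ hξ c hc
  convert hξ using 4 with k
  have h1 := (((hc k).comp hF).norm.pow 2)
  exact ((ENNReal.continuous_ofReal.tendsto _).comp h1).liminf_eq.symm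

/-! ### Fourier series of real `L²` functions on the torus. -/

lemma coeff_congr_ae {u v : Torus → ℝ} (h : u =ᵐ[torusMeasure] v) : coeff u = coeff v := by
  ext n
  refine integral_congr_ae (μ := torusMeasure) ?_
  filter_upwards [h] with x hx
  rw [hx]

lemma coeff_eq_integral (u : Torus → ℝ) (n : Fin 2 → ℤ) :
    coeff u n = ∫ x, UnitAddTorus.mFourier (-n) x * (u x : ℂ) ∂torusMeasure := rfl

lemma conj_coeff (u : Torus → ℝ) (n : Fin 2 → ℤ) :
    (starRingEnd ℂ) (coeff u n) = coeff u (-n) := by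
  rw [coeff_eq_integral, coeff_eq_integral, ← integral_conj]
  simp [UnitAddTorus.mFourier_neg]

/-- The Fourier basis of `L²(𝕋²)`, with the measure written as `torusMeasure`. -/
def torusBasis : HilbertBasis (Fin 2 → ℤ) ℂ (Lp ℂ 2 torusMeasure) :=
  UnitAddTorus.mFourierBasis

lemma torusBasis_repr (f : Lp ℂ 2 torusMeasure) (n : Fin 2 → ℤ) :
    torusBasis.repr f n = ∫ x, UnitAddTorus.mFourier (-n) x * f x ∂torusMeasure :=
  UnitAddTorus.mFourierBasis_repr f n

lemma hasSum_conj_mul_torus (f g : Lp ℂ 2 torusMeasure) :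
    HasSum (fun n => (starRingEnd ℂ) (∫ x, UnitAddTorus.mFourier (-n) x * f x ∂torusMeasure) *
      ∫ x, UnitAddTorus.mFourier (-n) x * g x ∂torusMeasure)
      (∫ x, (starRingEnd ℂ) (f x) * g x ∂torusMeasure) :=
  UnitAddTorus.hasSum_prod_mFourierCoeff f g

lemma integral_mFourier_mul_toLp {f : Torus → ℂ} (hf : MemLp f 2 torusMeasure) (n : Fin 2 → ℤ) :
    ∫ x, UnitAddTorus.mFourier (-n) x * hf.toLp f x ∂torusMeasure =
      ∫ x, UnitAddTorus.mFourier (-n) x * f x ∂torusMeasure := by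
  refine integral_congr_ae ?_
  filter_upwards [hf.coeFn_toLp] with x hx
  rw [hx]

lemma Lp_ext_coeff {u v : Lp ℝ 2 torusMeasure} (h : ∀ n, coeff u n = coeff v n) : u = v := by
  have hu : MemLp (fun x => (u x : ℂ)) 2 torusMeasure := (Lp.memLp u).ofReal
  have hv : MemLp (fun x => (v x : ℂ)) 2 torusMeasure := (Lp.memLp v).ofReal
  have e : hu.toLp _ = hv.toLp _ := by
    apply torusBasis.repr.injective
    ext n
    rw [torusBasis_repr, torusBasis_repr, integral_mFourier_mul_toLp,
      integral_mFourier_mul_toLp]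
    exact h n
  have e' := (MemLp.toLp_eq_toLp_iff hu hv).1 e
  refine Lp.ext ?_
  filter_upwards [e'] with x hx
  exact Complex.ofReal_injective hx

lemma mFourier_mul_memLp {f : Torus → ℂ} (hf : MemLp f 2 torusMeasure) (n : Fin 2 → ℤ) :
    MemLp (fun x => UnitAddTorus.mFourier n x * f x) 2 torusMeasure := by
  refine hf.of_le_mul (c := 1) ((UnitAddTorus.mFourier n).continuous.aestronglyMeasurable.mul
    hf.aestronglyMeasurable) (.of_forall fun x => ?_)
  rw [norm_mul]
  gcongr
  exact ((UnitAddTorus.mFourier n).norm_coe_le_norm x).trans UnitAddTorus.mFourier_norm.le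

lemma exists_Lp_coeff_eq {c : (Fin 2 → ℤ) → ℂ} (hs : Summable fun n => ‖c n‖ ^ 2)
    (hc : ∀ n, c (-n) = (starRingEnd ℂ) (c n)) :
    ∃ v : Lp ℝ 2 torusMeasure, ∀ n, coeff v n = c n := by
  have hmem : Memℓp c 2 := memℓp_gen (by simpa using hs)
  set U : Lp ℂ 2 torusMeasure := torusBasis.repr.symm ⟨c, hmem⟩ with hU
  have hUc : ∀ n, ∫ x, UnitAddTorus.mFourier (-n) x * U x ∂torusMeasure = c n := by
    intro n
    rw [← torusBasis_repr, hU, LinearIsometryEquiv.apply_symm_apply]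
  have hint : ∀ n, Integrable (fun x => UnitAddTorus.mFourier (-n) x * U x) torusMeasure :=
    fun n => (mFourier_mul_memLp (Lp.memLp U) (-n)).integrable (by norm_num)
  refine ⟨(Lp.memLp U).re.toLp _, fun n => ?_⟩
  rw [coeff_congr_ae (Lp.memLp U).re.coeFn_toLp, coeff_eq_integral]
  -- The real part of `U` has coefficients `(c(n) + conj c(-n))/2`, equal to `c(n)` by Hermitian
  -- symmetry.
  have e : ∀ x, UnitAddTorus.mFourier (-n) x * ((RCLike.re (U x) : ℝ) : ℂ) =
      2⁻¹ * (UnitAddTorus.mFourier (-n) x * U x +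
        (starRingEnd ℂ) (UnitAddTorus.mFourier (-(-n)) x * U x)) := by
    intro x
    rw [map_mul, ← UnitAddTorus.mFourier_neg, neg_neg, RCLike.re_eq_complex_re,
      Complex.re_eq_add_conj]
    ring
  simp only [e]
  have hconj : Integrable
      (fun x => (starRingEnd ℂ) (UnitAddTorus.mFourier (-(-n)) x * U x)) torusMeasure :=
    (RCLike.conjCLE (K := ℂ)).toContinuousLinearMap.integrable_comp (hint (-n))
  rw [integral_const_mul, integral_add (hint n) hconj, hUc]
  rw [integral_conj, hUc, hc, Complex.conj_conj]
  ring

/-- Parseval's identity for the pair `e^{ik·x} v` and `v`; `v` being real turns the conjugate of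
`v̂(m - k)` into `v̂(k - m)`. -/
lemma hasSum_coeff_mul_coeff (v : Lp ℝ 2 torusMeasure) (k : Fin 2 → ℤ) :
    HasSum (fun m => coeff v m * coeff v (k - m)) (2 * coeff (halfSq v) k) := by
  have hv : MemLp (fun x => (v x : ℂ)) 2 torusMeasure := (Lp.memLp v).ofReal
  have hf := mFourier_mul_memLp hv k
  have h := hasSum_conj_mul_torus (hf.toLp _) (hv.toLp _)
  simp only [integral_mFourier_mul_toLp] at h
  have e2 : ∫ x, (starRingEnd ℂ) (hf.toLp _ x) * hv.toLp _ x ∂torusMeasure =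
      2 * coeff (halfSq v) k := by
    rw [coeff_eq_integral, ← integral_const_mul]
    refine integral_congr_ae ?_
    filter_upwards [hf.coeFn_toLp, hv.coeFn_toLp] with x h1 h2
    rw [h1, h2, map_mul, ← UnitAddTorus.mFourier_neg, Complex.conj_ofReal, halfSq]
    push_cast
    ring
  rw [e2] at h
  refine h.congr_fun fun m => ?_
  have e1 : ∫ x, UnitAddTorus.mFourier (-m) x * (UnitAddTorus.mFourier k x * (v x : ℂ))
      ∂torusMeasure = coeff v (m - k) := by
    rw [coeff_eq_integral]
    congr with x
    rw [← mul_assoc, ← UnitAddTorus.mFourier_add]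
    congr 3
    ring
  rw [e1, conj_coeff, neg_sub, coeff_eq_integral v m]
  ring

/-! ### The linear solution and its energies. -/

lemma isLinearSolution_iff {v : Torus → ℝ} :
    IsLinearSolution ξ v ↔ ∀ n, coeff v n = ((symbolL n)⁻¹ : ℝ) * ξ.coeff n := by
  constructor
  · intro h n
    by_cases hn : n 0 = 0
    · rw [h.zero_average n hn, symbolL_eq_zero hn]
      simp
    · have : (symbolL n : ℂ) ≠ 0 := by exact_mod_cast (symbolL_pos hn).ne'
      rw [← h.equation n hn, Complex.ofReal_inv, inv_mul_cancel_left₀ this]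
  · intro h
    refine ⟨fun n hn => ?_, fun n hn => ?_⟩
    · rw [h, symbolL_eq_zero hn]
      simp
    · have : (symbolL n : ℂ) ≠ 0 := by exact_mod_cast (symbolL_pos hn).ne'
      rw [h, Complex.ofReal_inv, mul_inv_cancel_left₀ this]

lemma existsUnique_isLinearSolution
    (hs : Summable fun n => (symbolL n)⁻¹ ^ 2 * ‖ξ.coeff n‖ ^ 2) :
    ∃! v : Lp ℝ 2 torusMeasure, IsLinearSolution ξ v := by
  obtain ⟨v, hv⟩ := exists_Lp_coeff_eq (c := fun n => ((symbolL n)⁻¹ : ℝ) * ξ.coeff n)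
    (hs.congr fun n => by rw [norm_mul, mul_pow, Complex.norm_real, Real.norm_eq_abs, sq_abs])
    (fun n => by rw [symbolL_neg, ξ.coeff_neg, map_mul, Complex.conj_ofReal])
  refine ⟨v, isLinearSolution_iff.2 hv, fun u hu => Lp_ext_coeff fun n => ?_⟩
  rw [hv, isLinearSolution_iff.1 hu]

lemma norm_halfInv_sq (n : Fin 2 → ℤ) : ‖halfInv n‖ ^ 2 = |wave n 0|⁻¹ := by
  rw [halfInv, Complex.norm_real, Real.norm_eq_abs, sq_abs,
    ← Real.rpow_mul_natCast (abs_nonneg _), ← Real.rpow_neg_one]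
  norm_num

lemma norm_coeffD1_sq (u : Torus → ℝ) (n : Fin 2 → ℤ) :
    ‖coeffD1 u n‖ ^ 2 = wave n 0 ^ 2 * ‖coeff u n‖ ^ 2 := by
  simp [coeffD1, mul_pow]

lemma norm_coeffD2_sq (u : Torus → ℝ) (n : Fin 2 → ℤ) :
    ‖coeffD2 u n‖ ^ 2 = wave n 1 ^ 2 * ‖coeff u n‖ ^ 2 := by
  simp [coeffD2, mul_pow]

lemma norm_halfInv_mul_coeffD1_sq (u : Torus → ℝ) (n : Fin 2 → ℤ) :
    ‖halfInv n * coeffD1 u n‖ ^ 2 = |wave n 0| * ‖coeff u n‖ ^ 2 := by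
  rw [norm_mul, mul_pow, norm_halfInv_sq, norm_coeffD1_sq, ← sq_abs (wave n 0), ← mul_assoc]
  congr 1
  by_cases h : |wave n 0| = 0
  · simp [h]
  · field_simp

lemma IsLinearSolution.norm_coeffD1_sq_add {v : Torus → ℝ} (hv : IsLinearSolution ξ v)
    (n : Fin 2 → ℤ) :
    ‖coeffD1 v n‖ ^ 2 + ‖halfInv n * coeffD2 v n‖ ^ 2 = (symbolL n)⁻¹ * ‖ξ.coeff n‖ ^ 2 := by
  rw [norm_mul, mul_pow, norm_halfInv_sq, norm_coeffD1_sq, norm_coeffD2_sq, ← mul_assoc,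
    ← add_mul, ← symbolL, isLinearSolution_iff.1 hv, norm_mul, mul_pow, Complex.norm_real,
    Real.norm_eq_abs, sq_abs, ← mul_assoc]
  congr 1
  by_cases h : symbolL n = 0
  · simp [h]
  · field_simp

lemma IsLinearSolution.harmonicEnergy_eq {v : Torus → ℝ} (hv : IsLinearSolution ξ v) :
    harmonicEnergy v = ∑' n, ENNReal.ofReal ((symbolL n)⁻¹ * ‖ξ.coeff n‖ ^ 2) := by
  rw [harmonicEnergy, ← ENNReal.tsum_add]
  congr with n
  rw [← ENNReal.ofReal_add (by positivity) (by positivity), hv.norm_coeffD1_sq_add]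

lemma tsum_subtype_div_symbolL (ξ : PeriodicDistribution) :
    ∑' n : {n : Fin 2 → ℤ // n 0 ≠ 0}, ENNReal.ofReal (‖ξ.coeff n.1‖ ^ 2 / symbolL n.1) =
      ∑' n, ENNReal.ofReal ((symbolL n)⁻¹ * ‖ξ.coeff n‖ ^ 2) := by
  simp only [div_eq_inv_mul]
  refine tsum_subtype_eq_of_support_subset (s := {n : Fin 2 → ℤ | n 0 ≠ 0})
    (f := fun n => ENNReal.ofReal ((symbolL n)⁻¹ * ‖ξ.coeff n‖ ^ 2)) fun n hn h0 => hn ?_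
  simp [symbolL_eq_zero h0]

lemma IsLinearSolution.quarticEnergy_lt_top {v : Lp ℝ 2 torusMeasure}
    (hv : IsLinearSolution ξ v)
    (hc : ∀ c : (Fin 2 → ℤ) → ℂ,
      (∀ k, HasSum (fun m => (((symbolL m)⁻¹ * (symbolL (k - m))⁻¹ : ℝ) : ℂ) *
        (ξ.coeff m * ξ.coeff (k - m))) (c k)) →
      ∑' k, ENNReal.ofReal |wave k 0| * ENNReal.ofReal (‖c k‖ ^ 2) < ⊤) :
    quarticEnergy v < ⊤ := by
  have h := hc (fun k => 2 * coeff (halfSq v) k) fun k =>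
    (hasSum_coeff_mul_coeff v k).congr_fun fun m => by
      rw [isLinearSolution_iff.1 hv, isLinearSolution_iff.1 hv]
      push_cast
      ring
  refine lt_of_le_of_lt (ENNReal.tsum_le_tsum fun n => ?_) h
  rw [norm_halfInv_mul_coeffD1_sq, ← ENNReal.ofReal_mul (abs_nonneg _)]
  refine ENNReal.ofReal_le_ofReal (mul_le_mul_of_nonneg_left ?_ (abs_nonneg _))
  rw [norm_mul, mul_pow, Complex.norm_ofNat]
  nlinarith [sq_nonneg ‖coeff (halfSq v) n‖]

/-- The noise term is `-2h` with `h = σ⁻¹ |ξ̂|²` the harmonic part, so the mode is at most `-h + 2βγ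
+ γ²`, where `β` and `γ` are the norms of the two parts of the squared difference. Then `2βγ ≤ β²/2
+ 2γ²` and `β² ≤ h`. -/
lemma IsLinearSolution.totalEnergyMode_le {v : Torus → ℝ} (hv : IsLinearSolution ξ v)
    (n : Fin 2 → ℤ) :
    totalEnergyMode ξ v n ≤ -(1 / 2) * ((symbolL n)⁻¹ * ‖ξ.coeff n‖ ^ 2) +
      3 * ‖halfInv n * coeffD1 (halfSq v) n‖ ^ 2 := by
  have h1 := hv.norm_coeffD1_sq_add n
  have h2 : (ξ.coeff n * (starRingEnd ℂ) (coeff v n)).re = (symbolL n)⁻¹ * ‖ξ.coeff n‖ ^ 2 := by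
    rw [isLinearSolution_iff.1 hv, map_mul, Complex.conj_ofReal, mul_left_comm, Complex.mul_conj,
      Complex.normSq_eq_norm_sq, ← Complex.ofReal_mul, Complex.ofReal_re]
  rw [totalEnergyMode, h2, mul_sub]
  have h3 := norm_sub_le (halfInv n * coeffD2 v n) (halfInv n * coeffD1 (halfSq v) n)
  have h4 := pow_le_pow_left₀ (norm_nonneg _) h3 2
  nlinarith [sq_nonneg (‖halfInv n * coeffD2 v n‖ - 2 * ‖halfInv n * coeffD1 (halfSq v) n‖),
    sq_nonneg ‖coeffD1 v n‖]

/-- Once a finite set carries enough of the divergent `h`, every larger finite set does too, as `h ≥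
0`, while `q` contributes a bounded amount. This gives convergence to `-∞` along all finite sets. -/
lemma hasSum_coe_bot {ι : Type*} {e h q : ι → ℝ} (hle : ∀ n, e n ≤ -(1 / 2) * h n + 3 * q n)
    (hh : ∀ n, 0 ≤ h n) (hns : ¬ Summable h) (hq : ∀ n, 0 ≤ q n) (hqs : Summable q) :
    HasSum (fun n => (e n : EReal)) ⊥ := by
  rw [HasSum, EReal.tendsto_nhds_bot_iff_real]
  intro x
  obtain ⟨F, hF⟩ : ∃ F : Finset ι, 2 * (3 * ∑' n, q n - x) < ∑ n ∈ F, h n := by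
    by_contra! hb
    exact hns (summable_of_sum_le hh hb)
  simp only [SummationFilter.unconditional_filter]
  filter_upwards [Filter.eventually_ge_atTop F] with s hs
  have hcoe : ∑ n ∈ s, (e n : EReal) = ((∑ n ∈ s, e n : ℝ) : EReal) :=
    (map_sum (⟨⟨Real.toEReal, EReal.coe_zero⟩, EReal.coe_add⟩ : ℝ →+ EReal) e s).symm
  rw [hcoe, EReal.coe_lt_coe_iff]
  have h1 : ∑ n ∈ s, e n ≤ -(1 / 2) * ∑ n ∈ s, h n + 3 * ∑ n ∈ s, q n := by
    rw [Finset.mul_sum, Finset.mul_sum, ← Finset.sum_add_distrib]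
    exact Finset.sum_le_sum fun n _ => hle n
  have h2 := Finset.sum_le_sum_of_subset_of_nonneg hs fun n _ _ => hh n
  have h3 := hqs.sum_le_tsum s fun n _ => hq n
  linarith

end Ripple

end

theorem mainTheorem11 (μ : Measure Ripple.PeriodicDistribution) (hμ : Ripple.IsWhiteNoise μ) :
    ∀ᵐ ξ ∂μ,
      (∃! v : Lp ℝ 2 Ripple.torusMeasure, Ripple.IsLinearSolution ξ v) ∧
      ∀ v : Lp ℝ 2 Ripple.torusMeasure, Ripple.IsLinearSolution ξ v →
        Ripple.harmonicEnergy v =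
            ∑' n : {n : Fin 2 → ℤ // n 0 ≠ 0},
              ENNReal.ofReal (‖ξ.coeff n.1‖ ^ 2 / Ripple.symbolL n.1) ∧
        Ripple.harmonicEnergy v = ⊤ ∧
        Ripple.quarticEnergy v < ⊤ ∧
        HasSum (fun n : Fin 2 → ℤ => (Ripple.totalEnergyMode ξ v n : EReal)) ⊥ ∧
        Ripple.totalEnergy ξ v = ⊥ := by
  filter_upwards [hμ.ae_summable (fun n => sq_nonneg _) Ripple.summable_inv_symbolL_sq,
    hμ.ae_tsum_eq_top (fun n => inv_nonneg.2 (Ripple.symbolL_nonneg n))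
      Ripple.not_summable_inv_symbolL Ripple.summable_inv_symbolL_sq,
    hμ.ae_tsum_convolution_lt_top] with ξ hs htop hconv
  refine ⟨Ripple.existsUnique_isLinearSolution hs, fun v hv => ?_⟩
  have hq := hv.quarticEnergy_lt_top hconv
  have hsum : HasSum (fun n : Fin 2 → ℤ => (Ripple.totalEnergyMode ξ v n : EReal)) ⊥ := by
    refine Ripple.hasSum_coe_bot hv.totalEnergyMode_le
      (fun n => mul_nonneg (inv_nonneg.2 (Ripple.symbolL_nonneg n)) (by positivity))
      (fun h => h.tsum_ofReal_ne_top htop) (fun n => by positivity) ?_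
    refine (ENNReal.summable_toReal hq.ne).congr fun n => ?_
    rw [ENNReal.toReal_ofReal (by positivity)]
  exact ⟨hv.harmonicEnergy_eq.trans (Ripple.tsum_subtype_div_symbolL ξ).symm,
    hv.harmonicEnergy_eq.trans htop, hq, hsum, hsum.tsum_eq⟩
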